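/- Let $H_1,H_2$ be complex Hilbert spaces, let $B(H_i)$ be the algebra of bounded operators and $K(H_i)\subseteq B(H_i)$ the algebra of compact operators on $H_i$. We identify $K(H_i)^{**}$ with $B(H_i)$ canonically, $F\in K(H_i)^{**}$ being the operator with $\langle x,Fy\rangle=F(k\mapsto\langle x,ky\rangle)$ for all $x,y\in H_i$. For a bounded linear map $\Phi:K(H_1)\to K(H_2)$ let $\Phi^{**}:B(H_1)\to B(H_2)$ be its bitranspose. For a bounded linear map $T:K(H_1)\to B(H_2)$ we write $T(1)\in B(H_2)$ for the value at the identity operator $1\in B(H_1)=K(H_1)^{**}$ of the weak*-continuous extension of $T$ to $B(H_1)$, i.e. $\langle x,T(1)y\rangle=1\,(k\mapsto\langle x,T(k)y\rangle)$ for all $x,y\in H_2$, with $1$ regarded as an element of $K(H_1)^{**}$. A Jordan homomorphism is a linear map $T$ with $T(a^2)=T(a)^2$ for all $a$. Let $\Phi,\Upsilon:K(H_1)\to K(H_2)$ be linear maps such that $\Phi$ is continuous and $(\Phi,\Upsilon)$ is Jordan-triple multiplicative, that is, $\Phi(aba)=\Phi(a)\Upsilon(b)\Phi(a)$ and $\Upsilon(aba)=\Upsilon(a)\Phi(b)\Upsilon(a)$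 for all $a,b\in K(H_1)$. Then: (a) there exists a continuous Jordan homomorphism $T:K(H_1)\to B(H_2)$ such that $\Phi(a)=T(a)\,\Phi^{**}(1)$ for every $a\in K(H_1)$, and $\Phi^{**}(1)B(H_2)=T(1)B(H_2)$; (b) there exists a continuous Jordan homomorphism $S:K(H_1)\to B(H_2)$ such that $\Phi(a)=\Phi^{**}(1)\,S(a)$ for every $a\in K(H_1)$, and $B(H_2)\,\Phi^{**}(1)=B(H_2)\,S(1)$. -/

import Mathlib

open Filter Topology

section Algebra

variable {A B : Type*} [NonUnitalRing A] [Module ℂ A] [NonUnitalRing B] [Module ℂ B]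

/-- `Ψ` is a pointwise-generalized-inverse of `Φ`: `Φ(aba) = Φ(a) Ψ(b) Φ(a)` for all `a`, `b`. -/
def IsPGInverse (Φ Ψ : A →ₗ[ℂ] B) : Prop :=
  ∀ a b : A, Φ (a * b * a) = Φ a * Ψ b * Φ a

/-- The pair `(Φ, Ψ)` is Jordan-triple multiplicative: each map is a pointwise-generalized-inverse
of the other one. -/
def IsJordanTripleMultiplicative (Φ Ψ : A →ₗ[ℂ] B) : Prop :=
  IsPGInverse Φ Ψ ∧ IsPGInverse Ψ Φ

/-- A Jordan homomorphism: a linear map with `T(a²) = T(a)²` for all `a`. -/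
def IsJordanHom (T : A →ₗ[ℂ] B) : Prop :=
  ∀ a : A, T (a * a) = T a * T a

end Algebra

/-- The compact operators on `H`, as a subalgebra of `B(H)`. -/
def compactSubalgebra (H : Type*) [NormedAddCommGroup H] [InnerProductSpace ℂ H] :
    NonUnitalSubalgebra ℂ (H →L[ℂ] H) where
  carrier := {f | IsCompactOperator f}
  add_mem' hf hg := hf.add hg
  zero_mem' := isCompactOperator_zero
  smul_mem' c _ hf := hf.smul c
  mul_mem' {_ g} hf _ := hf.comp_clm g

/-- The Banach algebra `K(H)` of compact operators on `H`, with the product and the operator norm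
of `B(H)`. -/
def CompactOp (H : Type*) [NormedAddCommGroup H] [InnerProductSpace ℂ H] : Type _ :=
  compactSubalgebra H

namespace CompactOp

variable (H : Type*) [NormedAddCommGroup H] [InnerProductSpace ℂ H]

noncomputable instance instNonUnitalNormedRing : NonUnitalNormedRing (CompactOp H) :=
  inferInstanceAs (NonUnitalNormedRing (compactSubalgebra H))

noncomputable instance instModule : Module ℂ (CompactOp H) :=
  inferInstanceAs (Module ℂ (compactSubalgebra H))

noncomputable instance instNormedSpace : NormedSpace ℂ (CompactOp H) where
  norm_smul_le c k := norm_smul_le c (k.1 : H →L[ℂ] H)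

instance instIsScalarTower : IsScalarTower ℂ (CompactOp H) (CompactOp H) :=
  inferInstanceAs (IsScalarTower ℂ (compactSubalgebra H) (compactSubalgebra H))

instance instSMulCommClass : SMulCommClass ℂ (CompactOp H) (CompactOp H) :=
  inferInstanceAs (SMulCommClass ℂ (compactSubalgebra H) (compactSubalgebra H))

/-- The inclusion `K(H) ⊆ B(H)`. -/
noncomputable def incl : CompactOp H →L[ℂ] (H →L[ℂ] H) :=
  LinearMap.mkContinuous
    { toFun := fun k => k.1, map_add' := fun _ _ => rfl, map_smul' := fun _ _ => rfl }
    1 (fun k => by rw [one_mul]; exact le_refl ‖k.1‖)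

end CompactOp

/-- The Banach space bidual `X**`. -/
abbrev Bidual (X : Type*) [NormedAddCommGroup X] [NormedSpace ℂ X] : Type _ :=
  StrongDual ℂ (StrongDual ℂ X)

/-- The bitranspose `Φ** : X** → Y**` of a bounded operator `Φ : X → Y`,
`(Φ** F)(φ) = F(φ ∘ Φ)`. -/
noncomputable def bitranspose {X Y : Type*} [NormedAddCommGroup X] [NormedSpace ℂ X]
    [NormedAddCommGroup Y] [NormedSpace ℂ Y] (Φ : X →L[ℂ] Y) : Bidual X →L[ℂ] Bidual Y :=
  ContinuousLinearMap.precomp ℂ (ContinuousLinearMap.precomp ℂ Φ)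

section Identification

variable {X H : Type*} [NormedAddCommGroup X] [NormedSpace ℂ X]
  [NormedAddCommGroup H] [InnerProductSpace ℂ H]

/-- The functional `k ↦ ⟪x, L(k) y⟫` on `X`, for an operator-valued bounded linear map
`L : X → B(H)`. -/
noncomputable def matrixCoeff (L : X →L[ℂ] (H →L[ℂ] H)) (x y : H) : StrongDual ℂ X :=
  (innerSL ℂ x) ∘L (ContinuousLinearMap.apply ℂ H y) ∘L L

theorem matrixCoeff_apply (L : X →L[ℂ] (H →L[ℂ] H)) (x y : H) (k : X) :
    matrixCoeff L x y k = inner ℂ x (L k y) := rfl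

theorem norm_matrixCoeff_le (L : X →L[ℂ] (H →L[ℂ] H)) (x y : H) :
    ‖matrixCoeff L x y‖ ≤ ‖L‖ * ‖x‖ * ‖y‖ := by
  refine ContinuousLinearMap.opNorm_le_bound _ (by positivity) fun k => ?_
  rw [matrixCoeff_apply]
  calc ‖inner ℂ x (L k y)‖ ≤ ‖x‖ * ‖L k y‖ := norm_inner_le_norm _ _
    _ ≤ ‖x‖ * (‖L k‖ * ‖y‖) := by gcongr; exact (L k).le_opNorm y
    _ ≤ ‖x‖ * ((‖L‖ * ‖k‖) * ‖y‖) := by gcongr; exact L.le_opNorm k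
    _ = ‖L‖ * ‖x‖ * ‖y‖ * ‖k‖ := by ring

/-- The bounded sesquilinear form `(y, x) ↦ conj (F (k ↦ ⟪x, L(k) y⟫))`. -/
noncomputable def bidualForm (L : X →L[ℂ] (H →L[ℂ] H)) (F : Bidual X) :
    H →L⋆[ℂ] H →L[ℂ] ℂ :=
  LinearMap.mkContinuous₂
    (LinearMap.mk₂'ₛₗ (starRingEnd ℂ) (RingHom.id ℂ)
      (fun y x => starRingEnd ℂ (F (matrixCoeff L x y)))
      (fun y y' x => by
        have : matrixCoeff L x (y + y') = matrixCoeff L x y + matrixCoeff L x y' := by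
          ext k; simp [matrixCoeff_apply]
        rw [this, map_add, map_add])
      (fun c y x => by
        have : matrixCoeff L x (c • y) = c • matrixCoeff L x y := by
          ext k; simp [matrixCoeff_apply]
        rw [this, map_smul]; simp)
      (fun y x x' => by
        have : matrixCoeff L (x + x') y = matrixCoeff L x y + matrixCoeff L x' y := by
          ext k; simp [matrixCoeff_apply]
        rw [this, map_add, map_add])
      (fun c y x => by
        have : matrixCoeff L (c • x) y = starRingEnd ℂ c • matrixCoeff L x y := by
          ext k; simp [matrixCoeff_apply, mul_comm]
        rw [this, map_smul]; simp))
    (‖F‖ * ‖L‖) (fun y x => by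
      simp only [LinearMap.mk₂'ₛₗ_apply, RCLike.norm_conj]
      calc ‖F (matrixCoeff L x y)‖ ≤ ‖F‖ * ‖matrixCoeff L x y‖ := F.le_opNorm _
        _ ≤ ‖F‖ * (‖L‖ * ‖x‖ * ‖y‖) := by gcongr; exact norm_matrixCoeff_le L x y
        _ = ‖F‖ * ‖L‖ * ‖y‖ * ‖x‖ := by ring)

variable [CompleteSpace H]

/-- For a bounded linear map `L : X → B(H)`, the operator `L~(F) ∈ B(H)` attached to `F ∈ X**` by
`⟪x, L~(F) y⟫ = F (k ↦ ⟪x, L(k) y⟫)`. -/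
noncomputable def opOfBidual (L : X →L[ℂ] (H →L[ℂ] H)) (F : Bidual X) : H →L[ℂ] H :=
  InnerProductSpace.continuousLinearMapOfBilin (bidualForm L F)

theorem inner_opOfBidual (L : X →L[ℂ] (H →L[ℂ] H)) (F : Bidual X) (x y : H) :
    inner ℂ x (opOfBidual L F y) = F (matrixCoeff L x y) := by
  rw [← inner_conj_symm, opOfBidual, InnerProductSpace.continuousLinearMapOfBilin_apply]
  simp [bidualForm]

/-- `opOfBidual L` as a linear map `X** → B(H)`. -/
noncomputable def opOfBidualₗ (L : X →L[ℂ] (H →L[ℂ] H)) : Bidual X →ₗ[ℂ] (H →L[ℂ] H) where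
  toFun := opOfBidual L
  map_add' F G := by
    ext y
    refine ext_inner_left ℂ fun x => ?_
    simp [inner_opOfBidual, inner_add_right]
  map_smul' c F := by
    ext y
    refine ext_inner_left ℂ fun x => ?_
    simp [inner_opOfBidual, inner_smul_right]

end Identification

theorem exists_bidual_limit {X ι : Type*} [NormedAddCommGroup X] [NormedSpace ℂ X]
    (u : ι → X) (C : ℝ) (hu : ∀ i, ‖u i‖ ≤ C) (U : Ultrafilter ι) :
    ∃ F : Bidual X, ∀ φ : StrongDual ℂ X, Tendsto (fun i => φ (u i)) U (𝓝 (F φ)) := by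
  let q : ι → WeakDual ℂ (StrongDual ℂ X) := fun i =>
    StrongDual.toWeakDual (NormedSpace.inclusionInDoubleDual ℂ X (u i))
  have hC := WeakDual.isCompact_closedBall (0 : Bidual X) C
  obtain ⟨F, -, hF⟩ := hC.ultrafilter_le_nhds (U.map q) (by
    rw [le_principal_iff]
    refine Filter.mem_map.mpr (Filter.Eventually.of_forall fun i => ?_)
    exact mem_closedBall_zero_iff.mpr ((NormedSpace.double_dual_bound ℂ X (u i)).trans (hu i)))
  have hF' : Tendsto q U (𝓝 F) := hF
  exact ⟨WeakDual.toStrongDual F, fun φ => ((WeakDual.eval_continuous φ).tendsto F).comp hF'⟩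

section Biduality

variable {H : Type*} [NormedAddCommGroup H] [InnerProductSpace ℂ H]

/-- The orthogonal projection onto the span of a finite set. -/
noncomputable def spanProj (s : Finset H) : H →L[ℂ] H :=
  (Submodule.span ℂ (s : Set H)).starProjection

theorem spanProj_apply_of_mem {s : Finset H} {x : H} (hx : x ∈ s) : spanProj s x = x :=
  Submodule.starProjection_eq_self_iff.mpr (Submodule.subset_span hx)

theorem norm_spanProj_le (s : Finset H) : ‖spanProj s‖ ≤ 1 :=
  Submodule.starProjection_norm_le _

theorem isCompactOperator_rankOne (x y : H) :
    IsCompactOperator (InnerProductSpace.rankOne ℂ x y : H →L[ℂ] H) := by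
  have h : IsCompactOperator (ContinuousLinearMap.toSpanSingleton ℂ x : ℂ →L[ℂ] H) :=
    isCompactOperator_of_locallyCompactSpace_rng (ContinuousLinearMap.toSpanSingleton ℂ x)
  rw [InnerProductSpace.rankOne_def']
  exact h.comp_clm (innerSL ℂ y)

theorem spanProj_eq_sum (s : Finset H) :
    ∃ (n : ℕ) (e : Fin n → H), spanProj s = ∑ i, InnerProductSpace.rankOne ℂ (e i) (e i) :=
  ⟨_, _, (stdOrthonormalBasis ℂ
    (Submodule.span ℂ (s : Set H))).starProjection_eq_sum_rankOne⟩

theorem isCompactOperator_spanProj (s : Finset H) : IsCompactOperator (spanProj s) := by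
  obtain ⟨n, e, h⟩ := spanProj_eq_sum s
  rw [h]
  exact (compactSubalgebra H).sum_mem (fun i _ => isCompactOperator_rankOne (e i) (e i))

variable (H) [CompleteSpace H]

/-- The canonical map `K(H)** → B(H)`, `⟪x, F y⟫ = F (k ↦ ⟪x, k y⟫)`. -/
noncomputable def compactBidualToOp : Bidual (CompactOp H) →ₗ[ℂ] (H →L[ℂ] H) :=
  opOfBidualₗ (CompactOp.incl H)

/-- The canonical map `B(H)** → B(H)`, `⟪x, G y⟫ = G (b ↦ ⟪x, b y⟫)`; it is the transpose of the
inclusion of the predual of `B(H)` into `B(H)*`. -/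
noncomputable def opBidualToOp : Bidual (H →L[ℂ] H) →ₗ[ℂ] (H →L[ℂ] H) :=
  opOfBidualₗ (ContinuousLinearMap.id ℂ (H →L[ℂ] H))

variable {H}

theorem compactBidualToOp_surjective : Function.Surjective (compactBidualToOp H) := by
  intro A
  let U : Ultrafilter (Finset H) := Ultrafilter.of atTop
  have hU : (U : Filter (Finset H)) ≤ atTop := Ultrafilter.of_le atTop
  let q : Finset H → CompactOp H := fun s =>
    ⟨spanProj s * A, (isCompactOperator_spanProj s).comp_clm A⟩
  obtain ⟨F, hF⟩ := exists_bidual_limit q ‖A‖ (fun s =>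
    calc ‖spanProj s * A‖ ≤ ‖spanProj s‖ * ‖A‖ := norm_mul_le _ _
      _ ≤ 1 * ‖A‖ := by gcongr; exact norm_spanProj_le s
      _ = ‖A‖ := one_mul _) U
  refine ⟨F, ?_⟩
  ext y
  refine ext_inner_left ℂ fun x => ?_
  have h2 : Tendsto (fun s => matrixCoeff (CompactOp.incl H) x y (q s)) U
      (𝓝 (inner ℂ x (A y))) := by
    refine tendsto_const_nhds.congr' (hU ?_)
    filter_upwards [eventually_ge_atTop ({A y} : Finset H)] with s hs
    have : matrixCoeff (CompactOp.incl H) x y (q s) = inner ℂ x (spanProj s (A y)) := rfl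
    rw [this, spanProj_apply_of_mem (hs (Finset.mem_singleton_self _))]
  exact (inner_opOfBidual _ _ _ _).trans (tendsto_nhds_unique (hF _) h2)

/-- `spanProj s` as an element of `K(H)`. -/
noncomputable def compactProj (s : Finset H) : CompactOp H :=
  ⟨spanProj s, isCompactOperator_spanProj s⟩

/-- The rank-one operator `z ↦ ⟪y, z⟫ x` as an element of `K(H)`. -/
noncomputable def compactRankOne (x y : H) : CompactOp H :=
  ⟨InnerProductSpace.rankOne ℂ x y, isCompactOperator_rankOne x y⟩

theorem norm_add_le_of_orthogonal (s : Finset H) (k l : CompactOp H) (hk : ‖k‖ ≤ 1)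
    (hl : ‖l‖ ≤ 1) (hks : compactProj s * k = k) (hls : compactProj s * l = 0) {a b : ℂ}
    (ha : ‖a‖ = 1) : ‖a • k + b • l‖ ≤ 1 + ‖b‖ ^ 2 := by
  refine ContinuousLinearMap.opNorm_le_bound _ (by positivity) fun x => ?_
  change ‖a • k.1 x + b • l.1 x‖ ≤ _
  have hkx : spanProj s (k.1 x) = k.1 x := congrArg (fun T : CompactOp H => T.1 x) hks
  have hlx : spanProj s (l.1 x) = 0 := congrArg (fun T : CompactOp H => T.1 x) hls
  have h0 : inner ℂ (k.1 x) (l.1 x) = 0 := by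
    rw [← hkx, spanProj, Submodule.inner_starProjection_left_eq_right]
    change inner ℂ (k.1 x) (spanProj s (l.1 x)) = 0
    rw [hlx, inner_zero_right]
  have h1 : ‖a • k.1 x + b • l.1 x‖ * ‖a • k.1 x + b • l.1 x‖
      = ‖a • k.1 x‖ * ‖a • k.1 x‖ + ‖b • l.1 x‖ * ‖b • l.1 x‖ :=
    norm_add_sq_eq_norm_sq_add_norm_sq_of_inner_eq_zero _ _
      (by rw [inner_smul_left, inner_smul_right, h0, mul_zero, mul_zero])
  have hk1 : ‖k.1 x‖ ≤ ‖x‖ := by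
    calc ‖k.1 x‖ ≤ ‖k.1‖ * ‖x‖ := k.1.le_opNorm x
      _ ≤ 1 * ‖x‖ := by gcongr; exact hk
      _ = ‖x‖ := one_mul _
  have hl1 : ‖l.1 x‖ ≤ ‖x‖ := by
    calc ‖l.1 x‖ ≤ ‖l.1‖ * ‖x‖ := l.1.le_opNorm x
      _ ≤ 1 * ‖x‖ := by gcongr; exact hl
      _ = ‖x‖ := one_mul _
  rw [norm_smul, norm_smul, ha, one_mul] at h1
  refine abs_le_of_sq_le_sq' ?_ (by positivity) |>.2
  have h2 : ‖k.1 x‖ ^ 2 ≤ ‖x‖ ^ 2 := by gcongr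
  have h3 : ‖l.1 x‖ ^ 2 ≤ ‖x‖ ^ 2 := by gcongr
  calc ‖a • k.1 x + b • l.1 x‖ ^ 2 = ‖k.1 x‖ ^ 2 + ‖b‖ ^ 2 * ‖l.1 x‖ ^ 2 := by
        rw [sq, h1]; ring
    _ ≤ ‖x‖ ^ 2 + ‖b‖ ^ 2 * ‖x‖ ^ 2 := by gcongr
    _ = (1 + ‖b‖ ^ 2) * 1 * ‖x‖ ^ 2 := by ring
    _ ≤ (1 + ‖b‖ ^ 2) * (1 + ‖b‖ ^ 2) * ‖x‖ ^ 2 := by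
        gcongr; exact le_add_of_nonneg_right (by positivity)
    _ = ((1 + ‖b‖ ^ 2) * ‖x‖) ^ 2 := by ring

theorem norm_add_mul_le_of_orthogonal (φ : StrongDual ℂ (CompactOp H)) (s : Finset H)
    (k l : CompactOp H) (hk : ‖k‖ ≤ 1) (hl : ‖l‖ ≤ 1) (hks : compactProj s * k = k)
    (hls : compactProj s * l = 0) {t : ℝ} (ht : 0 ≤ t) :
    ‖φ k‖ + t * ‖φ l‖ ≤ ‖φ‖ * (1 + t ^ 2) := by
  obtain ⟨u, hu, hu'⟩ := RCLike.exists_norm_eq_mul_self (φ k)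
  obtain ⟨v, hv, hv'⟩ := RCLike.exists_norm_eq_mul_self (φ l)
  have hb : ‖(t : ℂ) * v‖ = t := by rw [norm_mul, hv, mul_one, Complex.norm_of_nonneg ht]
  have h := norm_add_le_of_orthogonal s k l hk hl hks hls (b := (t : ℂ) * v) hu
  rw [hb] at h
  have e : φ (u • k + ((t : ℂ) * v) • l) = ((‖φ k‖ + t * ‖φ l‖ : ℝ) : ℂ) := by
    rw [map_add, map_smul, map_smul, smul_eq_mul, smul_eq_mul, mul_assoc, ← hu', ← hv']
    push_cast
    rfl
  have h2 := φ.le_opNorm (u • k + ((t : ℂ) * v) • l)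
  rw [e, Complex.norm_of_nonneg (by positivity)] at h2
  exact h2.trans (by gcongr)

theorem norm_compactProj_mul_le (s : Finset H) (k : CompactOp H) : ‖compactProj s * k‖ ≤ ‖k‖ :=
  calc ‖compactProj s * k‖ ≤ ‖compactProj s‖ * ‖k‖ := norm_mul_le _ _
    _ ≤ 1 * ‖k‖ := by gcongr; exact norm_spanProj_le s
    _ = ‖k‖ := one_mul _

theorem compactProj_mul_self (s : Finset H) : compactProj s * compactProj s = compactProj s :=
  Subtype.ext (Submodule.isIdempotentElem_starProjection _)

theorem norm_sub_spanProj_le (s : Finset H) (z : H) : ‖z - spanProj s z‖ ≤ ‖z‖ := by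
  have h := Submodule.norm_sq_eq_add_norm_sq_starProjection z (Submodule.span ℂ (s : Set H))
  have e : z - spanProj s z = (Submodule.span ℂ (s : Set H))ᗮ.starProjection z := by
    rw [Submodule.starProjection_orthogonal_val]; rfl
  rw [e]
  exact abs_le_of_sq_le_sq' (by
    nlinarith [sq_nonneg ‖(Submodule.span ℂ (s : Set H)).starProjection z‖]) (norm_nonneg _) |>.2

theorem norm_sub_compactProj_mul_le (s : Finset H) (k : CompactOp H) :
    ‖k - compactProj s * k‖ ≤ ‖k‖ :=
  ContinuousLinearMap.opNorm_le_bound _ (norm_nonneg _) fun x =>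
    (norm_sub_spanProj_le s (k.1 x)).trans (k.1.le_opNorm x)

theorem exists_compactProj_mul_close (k : CompactOp H) {δ : ℝ} (hδ : 0 < δ) :
    ∃ s : Finset H, ‖k - compactProj s * k‖ ≤ δ := by
  have hk : IsCompactOperator (k.1 : H →ₗ[ℂ] H) := k.2
  obtain ⟨K, hK, hKs⟩ := hk.image_closedBall_subset_compact 1
  obtain ⟨t, -, htf, htc⟩ := hK.finite_cover_balls hδ
  refine ⟨htf.toFinset, ?_⟩
  refine ContinuousLinearMap.opNorm_le_of_unit_norm (𝕜 := ℂ) hδ.le ?_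
  intro x hx
  obtain ⟨c, hc, hxc⟩ := Set.mem_iUnion₂.mp (htc (hKs ⟨x, by simp [hx], rfl⟩))
  have hc' : spanProj htf.toFinset c = c := spanProj_apply_of_mem (by simpa using hc)
  have e : k.1 x - spanProj htf.toFinset (k.1 x)
      = (k.1 x - c) - spanProj htf.toFinset (k.1 x - c) := by
    rw [map_sub, hc']; abel
  change ‖k.1 x - spanProj htf.toFinset (k.1 x)‖ ≤ δ
  rw [e]
  refine (norm_sub_spanProj_le _ _).trans ?_
  have := Metric.mem_ball.mp hxc
  rw [dist_eq_norm] at this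
  exact this.le

theorem exists_norm_sub_comp_le (φ : StrongDual ℂ (CompactOp H)) {t : ℝ} (ht : 0 < t) :
    ∃ s : Finset H,
      ‖φ - φ ∘L ContinuousLinearMap.mul ℂ (CompactOp H) (compactProj s)‖ ≤ (‖φ‖ + 1) * t := by
  obtain ⟨k, hk1, hk2⟩ : ∃ k : CompactOp H, ‖k‖ ≤ 1 ∧ ‖φ‖ - t ^ 2 / 2 < ‖φ k‖ := by
    obtain ⟨k, hk, hk'⟩ := φ.exists_lt_apply_of_lt_opNorm
      (show ‖φ‖ - t ^ 2 / 2 < ‖φ‖ by linarith [sq_pos_of_pos ht])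
    exact ⟨k, hk.le, hk'⟩
  obtain ⟨s, hs⟩ := exists_compactProj_mul_close k
    (show 0 < t ^ 2 / (2 * (‖φ‖ + 1)) by positivity)
  refine ⟨s, ContinuousLinearMap.opNorm_le_of_unit_norm (𝕜 := ℂ) (by positivity) ?_⟩
  intro m hm
  have h1 : ‖φ (k - compactProj s * k)‖ ≤ t ^ 2 / 2 := by
    calc ‖φ (k - compactProj s * k)‖ ≤ ‖φ‖ * ‖k - compactProj s * k‖ := φ.le_opNorm _
      _ ≤ (‖φ‖ + 1) * (t ^ 2 / (2 * (‖φ‖ + 1))) := by gcongr; linarith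
      _ = t ^ 2 / 2 := by field_simp
  have h2 : ‖φ k‖ ≤ ‖φ (compactProj s * k)‖ + t ^ 2 / 2 := by
    have : φ k = φ (compactProj s * k) + φ (k - compactProj s * k) := by
      rw [map_sub]; ring
    rw [this]
    exact (norm_add_le _ _).trans (by gcongr)
  have h3 := norm_add_mul_le_of_orthogonal φ s (compactProj s * k) (m - compactProj s * m)
    ((norm_compactProj_mul_le s k).trans hk1)
    ((norm_sub_compactProj_mul_le s m).trans hm.le)
    (by rw [← mul_assoc, compactProj_mul_self])
    (by rw [mul_sub, ← mul_assoc, compactProj_mul_self, sub_self]) ht.le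
  change ‖φ m - φ (compactProj s * m)‖ ≤ _
  rw [← map_sub]
  refine le_of_mul_le_mul_left ?_ ht
  nlinarith

theorem exists_comp_compactRankOne_eq (φ : StrongDual ℂ (CompactOp H)) (e : H) :
    ∃ z : H, ∀ k : CompactOp H,
      φ (compactRankOne e e * k) = matrixCoeff (CompactOp.incl H) e z k := by
  let χ : StrongDual ℂ H := LinearMap.mkContinuous
    { toFun := fun y => starRingEnd ℂ (φ (compactRankOne e y))
      map_add' := fun y y' => by
        have : compactRankOne e (y + y') = compactRankOne e y + compactRankOne e y' :=
          Subtype.ext (map_add _ _ _)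
        rw [this, map_add, map_add]
      map_smul' := fun c y => by
        have : compactRankOne e (c • y) = starRingEnd ℂ c • compactRankOne e y :=
          Subtype.ext (map_smulₛₗ _ _ _)
        rw [this, map_smul]; simp }
    (‖φ‖ * ‖e‖) (fun y => by
      change ‖starRingEnd ℂ (φ (compactRankOne e y))‖ ≤ _
      rw [RCLike.norm_conj, mul_assoc]
      refine (φ.le_opNorm _).trans ?_
      gcongr
      exact (InnerProductSpace.norm_rankOne e y).le)
  refine ⟨(InnerProductSpace.toDual ℂ H).symm χ, fun k => ?_⟩
  have h1 : compactRankOne e e * k = compactRankOne e (ContinuousLinearMap.adjoint k.1 e) :=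
    Subtype.ext (InnerProductSpace.rankOne_comp e e k.1)
  have h2 : χ (ContinuousLinearMap.adjoint k.1 e)
      = starRingEnd ℂ (φ (compactRankOne e (ContinuousLinearMap.adjoint k.1 e))) := rfl
  rw [h1, matrixCoeff_apply]
  change _ = inner ℂ e (k.1 _)
  rw [← ContinuousLinearMap.adjoint_inner_left, ← inner_conj_symm,
    InnerProductSpace.toDual_symm_apply, h2, Complex.conj_conj]

theorem compactBidualToOp_injective : Function.Injective (compactBidualToOp H) := by
  rw [injective_iff_map_eq_zero]
  intro F hF
  have hF0 : ∀ x y : H, F (matrixCoeff (CompactOp.incl H) x y) = 0 := by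
    intro x y
    rw [← inner_opOfBidual]
    change inner ℂ x (compactBidualToOp H F y) = 0
    rw [hF]; simp
  have hF1 : ∀ (φ : StrongDual ℂ (CompactOp H)) (s : Finset H),
      F (φ ∘L ContinuousLinearMap.mul ℂ (CompactOp H) (compactProj s)) = 0 := by
    intro φ s
    obtain ⟨n, e, he⟩ := spanProj_eq_sum s
    choose z hz using fun i => exists_comp_compactRankOne_eq φ (e i)
    have h1 : compactProj s = ∑ i, compactRankOne (e i) (e i) := by
      refine Subtype.ext (he.trans ?_)
      exact (map_sum (compactSubalgebra H).subtype (fun i => compactRankOne (e i) (e i)) _).symm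
    have h2 : φ ∘L ContinuousLinearMap.mul ℂ (CompactOp H) (compactProj s)
        = ∑ i, matrixCoeff (CompactOp.incl H) (e i) (z i) := by
      ext k
      rw [sum_apply]
      change φ (compactProj s * k) = _
      rw [h1, Finset.sum_mul, map_sum]
      exact Finset.sum_congr rfl fun i _ => hz i k
    rw [h2, map_sum]
    exact Finset.sum_eq_zero fun i _ => hF0 _ _
  ext φ
  have hb : ∀ t : ℝ, 0 < t → ‖F φ‖ ≤ ‖F‖ * (‖φ‖ + 1) * t := by
    intro t ht
    obtain ⟨s, hs⟩ := exists_norm_sub_comp_le φ ht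
    have e : F φ = F (φ - φ ∘L ContinuousLinearMap.mul ℂ (CompactOp H) (compactProj s)) := by
      rw [map_sub, hF1, sub_zero]
    rw [e, mul_assoc]
    exact (F.le_opNorm _).trans (by gcongr)
  have hlim : Tendsto (fun t : ℝ => ‖F‖ * (‖φ‖ + 1) * t) (𝓝[>] 0) (𝓝 0) := by
    have : Tendsto (fun t : ℝ => ‖F‖ * (‖φ‖ + 1) * t) (𝓝 0) (𝓝 (‖F‖ * (‖φ‖ + 1) * 0)) :=
      (continuous_const.mul continuous_id).tendsto 0
    rw [mul_zero] at this
    exact this.mono_left nhdsWithin_le_nhds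
  have h0 : ‖F φ‖ ≤ 0 := ge_of_tendsto hlim (by
    filter_upwards [self_mem_nhdsWithin] with t ht using hb t ht)
  simpa using h0

variable (H) in
/-- The canonical identification `K(H)** ≃ B(H)`, given by `⟪x, F y⟫ = F (k ↦ ⟪x, k y⟫)`. -/
noncomputable def compactBidualEquiv : Bidual (CompactOp H) ≃ₗ[ℂ] (H →L[ℂ] H) :=
  LinearEquiv.ofBijective (compactBidualToOp H)
    ⟨compactBidualToOp_injective, compactBidualToOp_surjective⟩

end Biduality

section Extension

variable {H₁ H₂ : Type*} [NormedAddCommGroup H₁] [InnerProductSpace ℂ H₁] [CompleteSpace H₁]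
  [NormedAddCommGroup H₂] [InnerProductSpace ℂ H₂] [CompleteSpace H₂]

/-- The bitranspose `Φ** : B(H₁) → B(H₂)` of a bounded operator `Φ : K(H₁) → K(H₂)`, under the
canonical identifications `K(Hᵢ)** = B(Hᵢ)`. -/
noncomputable def compactBitranspose (Φ : CompactOp H₁ →L[ℂ] CompactOp H₂) :
    (H₁ →L[ℂ] H₁) →ₗ[ℂ] (H₂ →L[ℂ] H₂) :=
  (compactBidualEquiv H₂).toLinearMap ∘ₗ (bitranspose Φ).toLinearMap ∘ₗ
    (compactBidualEquiv H₁).symm.toLinearMap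

/-- The weak*-continuous extension `B(H₁) → B(H₂)` of a bounded operator `T : K(H₁) → B(H₂)`:
the composition of `B(H₁) = K(H₁)**`, the bitranspose `T** : K(H₁)** → B(H₂)**`, and the canonical
map `B(H₂)** → B(H₂)`. -/
noncomputable def weakStarExtension (T : CompactOp H₁ →L[ℂ] (H₂ →L[ℂ] H₂)) :
    (H₁ →L[ℂ] H₁) →ₗ[ℂ] (H₂ →L[ℂ] H₂) :=
  opBidualToOp H₂ ∘ₗ (bitranspose T).toLinearMap ∘ₗ (compactBidualEquiv H₁).symm.toLinearMap

end Extension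

/-! If `K(H₁)` had a unit, `Φ(1)Υ(1)Φ(1) = Φ(1)` would hold and `a ↦ Φ(a)Υ(1)`, `a ↦ Υ(1)Φ(a)` would
be the required maps. The unit is replaced by the net of finite-rank projections `p_s`. Along an
ultrafilter, `Φ(p_s)` tends weakly to `X = Φ**(1)` and `Υ(p_s)` to some `Y`; then `T = Φ(·)Y` and `S
= YΦ(·)`.

Two obstacles arise. First, `Υ` is not assumed continuous, so `Y` exists only once `Υ(p_s)` is known
to be bounded (`exists_norm_compactProj_le`). Otherwise there would be orthogonal projections `d_n`
with `‖Υ(d_n)‖ ≥ 8ⁿ`; testing the triple identity on `a = ∑ 2⁻ⁿ d_n`, for which `a d_n a = 4⁻ⁿ d_n`,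
contradicts the boundedness of `Φ`.

Second, multiplication is not jointly weakly continuous, so the product of the two limits needs
care. For `q ≤ s ≤ t` the exact identity `Φ(q)Υ(s)Φ(t) = Φ(q)` holds
(`IsJordanTripleMultiplicative.mul_mul_eq_of_le`), so one may let `t` grow first and then `s`. This
gives `Φ(a)YX = Φ(a) = XYΦ(a)` and hence `XYX = X`, while `Φ(a)YΦ(a) = Φ(a²)` makes `T` and `S`
Jordan. Finally `T(1) = XY` and `S(1) = YX`, and `XYX = X` identifies the one-sided ideals. -/

/-! ### Algebra of Jordan-triple multiplicative pairs on idempotents -/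

section JordanPair

variable {A B : Type*} [NonUnitalRing A] [Module ℂ A] [NonUnitalRing B] [Module ℂ B]
  {Φ Υ : A →ₗ[ℂ] B}

/-- If `e` is idempotent and `ef + fe = 2e`, then `ef = e = fe`. -/
theorem mul_eq_left_of_add_eq {e f : B} (he : e * e = e) (h : e * f + f * e = e + e) :
    e * f = e ∧ f * e = e := by
  have h1 : e * f + e * f * e = e + e := by
    have := congrArg (fun x => e * x) h
    simpa only [mul_add, ← mul_assoc, he] using this
  have h2 : e * f * e + f * e = e + e := by
    have := congrArg (fun x => x * e) h
    simpa only [add_mul, mul_assoc, he] using this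
  -- Both products equal `2e - efe`, so `e` and `f` commute and the hypothesis becomes `2ef = 2e`.
  have h3 : e * f = f * e := by
    rw [add_comm] at h2
    exact add_right_cancel (h1.trans h2.symm)
  have h4 : (2 : ℂ) • (e * f) = (2 : ℂ) • e := by
    rw [two_smul, two_smul]
    nth_rewrite 2 [h3]
    exact h
  have h5 : e * f = e := smul_right_injective B (two_ne_zero (α := ℂ)) h4
  exact ⟨h5, h3 ▸ h5⟩

/-- Polarisation of the triple identity in its outer variable. -/
theorem IsPGInverse.map_add_map (h : IsPGInverse Φ Υ) (a b c : A) :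
    Φ (a * b * c + c * b * a) = Φ a * Υ b * Φ c + Φ c * Υ b * Φ a := by
  have h1 := h (a + c) b
  have e : (a + c) * b * (a + c) = a * b * a + c * b * c + (a * b * c + c * b * a) := by
    noncomm_ring
  rw [e, map_add, map_add, h a b, h c b, map_add Φ a c] at h1
  have e2 : (Φ a + Φ c) * Υ b * (Φ a + Φ c) = Φ a * Υ b * Φ a + Φ c * Υ b * Φ c +
      (Φ a * Υ b * Φ c + Φ c * Υ b * Φ a) := by noncomm_ring
  rw [e2] at h1
  exact add_left_cancel h1

/-- In the corner of an idempotent `t`, `Υ t` acts as an inverse of `Φ t`. -/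
theorem IsPGInverse.map_eq_of_corner (h : IsPGInverse Φ Υ) {t x : A} (ht : t * t = t)
    (hx : t * x * t = x) : Φ x * Υ t * Φ t = Φ x ∧ Φ t * Υ t * Φ x = Φ x := by
  have h1 := h t x
  have h2 := h t t
  rw [ht, ht] at h2
  rw [hx] at h1
  constructor
  · rw [h1]
    simp only [mul_assoc] at h2 ⊢
    rw [← h2]
  · rw [h1]
    simp only [← mul_assoc] at h2 ⊢
    rw [← h2]

/-- In the corner of `t`, multiplying by `Υ t` turns `q ≤ s` into a relation between `e = Φ q * Υ
t`, which is idempotent, and `f = Φ s * Υ t`: polarisation gives `ef + fe = 2e`, hence `ef = e`.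
Since `Υ s = Υ t * Φ s * Υ t`, the middle factor can be moved to level `t`. The three separate
levels are what later allows iterated limits. -/
theorem IsJordanTripleMultiplicative.mul_mul_eq_of_le (h : IsJordanTripleMultiplicative Φ Υ)
    {q s t : A} (hq : q * q = q) (ht : t * t = t) (hqs : q * s = q)
    (hsq : s * q = q) (hst : s * t = s) (hts : t * s = s) :
    Φ q * Υ s * Φ t = Φ q ∧ Φ t * Υ s * Φ q = Φ q := by
  have htq : t * q = q := by rw [← hsq, ← mul_assoc, hts]
  have hqt : q * t = q := by rw [← hqs, mul_assoc, hst]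
  have cq := h.1.map_eq_of_corner (x := q) ht (by rw [htq, hqt])
  have cs := h.1.map_eq_of_corner (x := s) ht (by rw [hts, hst])
  have us : Υ s = Υ t * Φ s * Υ t := by rw [← h.2, hts, hst]
  have hqtq : Φ q * Υ t * Φ q = Φ q := by rw [← h.1, hqt, hq]
  have hlin : Φ q * Υ t * Φ s + Φ s * Υ t * Φ q = Φ q + Φ q := by
    rw [← h.1.map_add_map, hqt, hqs, hst, hsq, map_add]
  have left : Φ q * Υ t * Φ s = Φ q := by
    have := (mul_eq_left_of_add_eq (e := Φ q * Υ t) (f := Φ s * Υ t)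
      (by rw [← mul_assoc, hqtq])
      (by rw [← mul_assoc, ← mul_assoc, ← add_mul, hlin, add_mul])).1
    rw [← cs.1, ← mul_assoc, ← mul_assoc, mul_assoc _ (Φ s), this, cq.1]
  have right : Φ s * Υ t * Φ q = Φ q := by
    have := add_left_cancel ((congrArg (· + Φ s * Υ t * Φ q) left).symm.trans hlin)
    exact this
  constructor
  · rw [us]
    calc Φ q * (Υ t * Φ s * Υ t) * Φ t = Φ q * Υ t * (Φ s * Υ t * Φ t) := by
          simp only [mul_assoc]
      _ = Φ q := by rw [cs.1, left]
  · rw [us]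
    calc Φ t * (Υ t * Φ s * Υ t) * Φ q = (Φ t * Υ t * Φ s) * Υ t * Φ q := by
          simp only [mul_assoc]
      _ = Φ q := by rw [cs.2, right]

/-- As `a = qaq`, the element `Φ a = Φ q * Υ a * Φ q` begins and ends with `Φ q`, which absorbs the
extra factors. -/
theorem IsJordanTripleMultiplicative.mul_mul_eq_of_corner
    (h : IsJordanTripleMultiplicative Φ Υ) {q s t a : A} (hq : q * q = q) (ht : t * t = t)
    (hqs : q * s = q) (hsq : s * q = q) (hst : s * t = s) (hts : t * s = s)
    (ha : q * a * q = a) : Φ a * Υ s * Φ t = Φ a ∧ Φ t * Υ s * Φ a = Φ a := by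
  have hle := h.mul_mul_eq_of_le hq ht hqs hsq hst hts
  have h1 : Φ a = Φ q * Υ a * Φ q := by rw [← h.1, ha]
  rw [h1]
  constructor
  · calc Φ q * Υ a * Φ q * Υ s * Φ t = Φ q * Υ a * (Φ q * Υ s * Φ t) := by
          simp only [mul_assoc]
      _ = _ := by rw [hle.1]
  · calc Φ t * Υ s * (Φ q * Υ a * Φ q) = (Φ t * Υ s * Φ q) * Υ a * Φ q := by
          simp only [mul_assoc]
      _ = _ := by rw [hle.2]

end JordanPair

/-! ### Finite-rank projections as an approximate identity -/

section CompactProj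

variable {H : Type*} [NormedAddCommGroup H] [InnerProductSpace ℂ H]

theorem spanProj_mul_of_subset {s t : Finset H} (h : s ⊆ t) :
    spanProj t * spanProj s = spanProj s := by
  ext x
  refine Submodule.starProjection_eq_self_iff.mpr ?_
  exact Submodule.span_mono (Finset.coe_subset.mpr h) (Submodule.starProjection_apply_mem _ x)

theorem mul_spanProj_of_subset {s t : Finset H} (h : s ⊆ t) :
    spanProj s * spanProj t = spanProj s := by
  ext x
  refine ext_inner_left ℂ fun y => ?_
  have e (u : Finset H) (z w : H) : inner ℂ z (spanProj u w) = inner ℂ (spanProj u z) w :=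
    (Submodule.inner_starProjection_left_eq_right _ z w).symm
  change inner ℂ y (spanProj s (spanProj t x)) = _
  rw [e, e, e]
  exact congrArg (fun T : H →L[ℂ] H => inner ℂ (T y) x) (spanProj_mul_of_subset h)

theorem compactProj_mul_of_subset {s t : Finset H} (h : s ⊆ t) :
    compactProj t * compactProj s = compactProj s :=
  Subtype.ext (spanProj_mul_of_subset h)

theorem mul_compactProj_of_subset {s t : Finset H} (h : s ⊆ t) :
    compactProj s * compactProj t = compactProj s :=
  Subtype.ext (mul_spanProj_of_subset h)

theorem norm_compactProj_le (s : Finset H) : ‖compactProj s‖ ≤ 1 := norm_spanProj_le s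

/-- Rank-one operators lie in finite-rank corners, so the corner identities apply to them and then
extend to `K(H)` by continuity. -/
theorem compactRankOne_mem_corner [DecidableEq H] (x y : H) :
    compactProj {x, y} * compactRankOne x y * compactProj {x, y} = compactRankOne x y := by
  refine Subtype.ext ?_
  change spanProj {x, y} * InnerProductSpace.rankOne ℂ x y * spanProj {x, y} =
    InnerProductSpace.rankOne ℂ x y
  ext z
  have hx : spanProj {x, y} x = x := spanProj_apply_of_mem (by simp)
  have hy : spanProj {x, y} y = y := spanProj_apply_of_mem (by simp)
  have e : inner ℂ y (spanProj {x, y} z) = inner ℂ (spanProj {x, y} y) z :=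
    (Submodule.inner_starProjection_left_eq_right _ y z).symm
  change spanProj {x, y} (InnerProductSpace.rankOne ℂ x y (spanProj {x, y} z)) = _
  rw [InnerProductSpace.rankOne_apply, InnerProductSpace.rankOne_apply, map_smul, hx, e, hy]

variable [CompleteSpace H]

/-- Needed to sum the series of projections in the boundedness argument. -/
instance CompactOp.instCompleteSpace : CompleteSpace (CompactOp H) :=
  (isClosed_setOfPred_isCompactOperator (σ₁₂ := RingHom.id ℂ) (M₁ := H) (M₂ := H)).completeSpace_coe

/-- Since `p_t p_s = p_s`, one has `k - p_t k = (1 - p_t)(k - p_s k)`. This monotonicity turns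
approximation by one projection into convergence of the net. -/
theorem norm_sub_compactProj_mul_le_of_subset {s t : Finset H} (h : s ⊆ t) (k : CompactOp H) :
    ‖k - compactProj t * k‖ ≤ ‖k - compactProj s * k‖ := by
  have e : k - compactProj t * k = (k - compactProj s * k) -
      compactProj t * (k - compactProj s * k) := by
    rw [mul_sub, ← mul_assoc, compactProj_mul_of_subset h]; abel
  rw [e]
  exact norm_sub_compactProj_mul_le _ _

/-- The finite-rank projections form a left approximate identity of `K(H)`. -/
theorem tendsto_compactProj_mul (k : CompactOp H) :
    Tendsto (fun s : Finset H => compactProj s * k) atTop (𝓝 k) := by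
  rw [Metric.tendsto_nhds]
  intro ε hε
  obtain ⟨s, hs⟩ := exists_compactProj_mul_close k (half_pos hε)
  filter_upwards [eventually_ge_atTop s] with t ht
  rw [dist_comm, dist_eq_norm]
  exact ((norm_sub_compactProj_mul_le_of_subset ht k).trans hs).trans_lt (half_lt_self hε)

/-- A continuous linear map on `K(H)` is determined by its values on rank-one operators. -/
theorem CompactOp.ext_rankOne {F : Type*} [NormedAddCommGroup F] [NormedSpace ℂ F]
    {f g : CompactOp H →L[ℂ] F} (h : ∀ x y, f (compactRankOne x y) = g (compactRankOne x y)) :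
    f = g := by
  ext k
  refine tendsto_nhds_unique ((f.continuous.tendsto k).comp (tendsto_compactProj_mul k))
    (((g.continuous.tendsto k).comp (tendsto_compactProj_mul k)).congr fun s => ?_)
  -- `p_s k` is the finite sum of the rank-one operators built from `e i` and `k* (e i)`.
  obtain ⟨n, e, he⟩ := spanProj_eq_sum s
  have h1 : compactProj s = ∑ i, compactRankOne (e i) (e i) := by
    refine Subtype.ext (he.trans ?_)
    exact (map_sum (compactSubalgebra H).subtype (fun i => compactRankOne (e i) (e i)) _).symm
  have h2 (i) : compactRankOne (e i) (e i) * k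
      = compactRankOne (e i) (ContinuousLinearMap.adjoint k.1 (e i)) :=
    Subtype.ext (InnerProductSpace.rankOne_comp (e i) (e i) k.1)
  simp only [Function.comp_apply, h1, Finset.sum_mul, map_sum, h2, h]

end CompactProj

/-! ### Automatic boundedness of `Υ` on projections -/

section Boundedness

variable {H B : Type*} [NormedAddCommGroup H] [InnerProductSpace ℂ H] [CompleteSpace H]
  [NonUnitalNormedRing B] [NormedSpace ℂ B]

/-- No pointwise-generalized-inverse pair has `Υ` growing like `8ⁿ` along an orthogonal sequence
of projections. -/
theorem exists_norm_lt_of_orthogonal {A : Type*} [NonUnitalNormedRing A] [NormedSpace ℂ A]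
    [IsScalarTower ℂ A A] [SMulCommClass ℂ A A] [CompleteSpace A]
    {Φ : A →L[ℂ] B} {Υ : A →ₗ[ℂ] B} (h : IsPGInverse Υ (Φ : A →ₗ[ℂ] B)) {d : ℕ → A} {C : ℝ}
    (hC : ∀ n, ‖d n‖ ≤ C) (hd : ∀ n, d n * d n = d n) (hd' : ∀ m n, m ≠ n → d m * d n = 0) :
    ∃ n, ‖Υ (d n)‖ < 8 ^ n := by
  have hs : Summable fun n => ((2 : ℂ)⁻¹ ^ n) • d n := by
    refine Summable.of_norm_bounded (g := fun n => (2⁻¹ : ℝ) ^ n * C)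
      ((summable_geometric_of_lt_one (by norm_num) (by norm_num)).mul_right C) fun n => ?_
    rw [norm_smul, norm_pow, norm_inv, Complex.norm_ofNat]
    gcongr
    exact hC n
  set a := ∑' n, ((2 : ℂ)⁻¹ ^ n) • d n with ha
  have hl (n) : a * d n = (2 : ℂ)⁻¹ ^ n • d n := by
    rw [ha, ← hs.tsum_mul_right, tsum_eq_single n, smul_mul_assoc, hd]
    intro m hm
    rw [smul_mul_assoc, hd' m n hm, smul_zero]
  have hr (n) : d n * a = (2 : ℂ)⁻¹ ^ n • d n := by
    rw [ha, ← hs.tsum_mul_left, tsum_eq_single n, mul_smul_comm, hd]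
    intro m hm
    rw [mul_smul_comm, hd' n m hm.symm, smul_zero]
  by_contra! hcon
  -- `a d_n a = 4⁻ⁿ d_n` gives `4⁻ⁿ Υ(d_n) = Υ(a)Φ(d_n)Υ(a)`. The right side is bounded in `n`,
  -- whereas growth `8ⁿ` would make the left side at least `2ⁿ`.
  have key (n : ℕ) : (2 : ℝ) ^ n ≤ ‖Υ a‖ * (‖Φ‖ * C) * ‖Υ a‖ := by
    have h1 : a * d n * a = (4 : ℂ)⁻¹ ^ n • d n := by
      rw [hl, smul_mul_assoc, hr, smul_smul, ← mul_pow]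
      norm_num
    have h2 := h a (d n)
    rw [h1, map_smul] at h2
    have h3 : ‖(4 : ℂ)⁻¹ ^ n • Υ (d n)‖ ≤ ‖Υ a‖ * (‖Φ‖ * C) * ‖Υ a‖ := by
      rw [h2]
      refine (norm_mul_le _ _).trans ?_
      gcongr
      refine (norm_mul_le _ _).trans ?_
      gcongr
      exact (Φ.le_opNorm _).trans (by gcongr; exact hC n)
    rw [norm_smul, norm_pow, norm_inv, Complex.norm_ofNat] at h3
    refine le_trans ?_ h3
    calc (2 : ℝ) ^ n = (4 : ℝ)⁻¹ ^ n * 8 ^ n := by rw [← mul_pow]; norm_num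
      _ ≤ _ := by gcongr; exact hcon n
  obtain ⟨n, hn⟩ := pow_unbounded_of_one_lt (‖Υ a‖ * (‖Φ‖ * C) * ‖Υ a‖) (one_lt_two (α := ℝ))
  exact (key n).not_gt hn

/-- A linear pointwise-generalized-inverse of a continuous map on `K(H)` is bounded on the set of
finite-rank projections. -/
theorem exists_norm_compactProj_le {Φ : CompactOp H →L[ℂ] B} {Υ : CompactOp H →ₗ[ℂ] B}
    (h : IsPGInverse Υ (Φ : CompactOp H →ₗ[ℂ] B)) :
    ∃ C, ∀ s : Finset H, ‖Υ (compactProj s)‖ ≤ C := by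
  classical
  by_contra! hcon
  -- From `p_t p_s p_t = p_s`: a bound at `t` controls every smaller projection, at the price of a
  -- square.
  have mono {s t : Finset H} (hst : s ⊆ t) : ‖Υ (compactProj s)‖ ≤
      ‖Υ (compactProj t)‖ * ‖Φ‖ * ‖Υ (compactProj t)‖ := by
    have h1 := h (compactProj t) (compactProj s)
    rw [compactProj_mul_of_subset hst, mul_compactProj_of_subset hst] at h1
    rw [h1]
    refine (norm_mul_le _ _).trans ?_
    gcongr
    refine (norm_mul_le _ _).trans ?_
    gcongr
    calc _ ≤ ‖Φ‖ * ‖compactProj s‖ := Φ.le_opNorm _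
      _ ≤ ‖Φ‖ * 1 := by gcongr; exact norm_compactProj_le s
      _ = _ := mul_one _
  have step (s : Finset H) (M : ℝ) : ∃ t, s ⊆ t ∧ M < ‖Υ (compactProj t)‖ := by
    -- If `s ∪ u` had norm at most `M`, the quadratic bound above would contradict this choice of
    -- `u`. Thus unboundedness persists above every `s`.
    obtain ⟨u, hu⟩ := hcon (|M| * ‖Φ‖ * |M|)
    refine ⟨s ∪ u, Finset.subset_union_left, ?_⟩
    by_contra! hle
    have h1 := mono (Finset.subset_union_right (s₁ := s) (s₂ := u))
    have h2 := hle.trans (le_abs_self M)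
    exact (h1.trans (by gcongr)).not_gt hu
  choose next hsub hnext using step
  -- Each term exceeds the norm of the previous one by more than `8ⁿ`, so the successive differences
  -- `d n`, which are orthogonal projections, satisfy `‖Υ (d n)‖ > 8ⁿ`.
  let σ : ℕ → Finset H := fun n =>
    Nat.rec ∅ (fun n s => next s (‖Υ (compactProj s)‖ + 8 ^ n)) n
  have hσ (n) : σ (n + 1) = next (σ n) (‖Υ (compactProj (σ n))‖ + 8 ^ n) := rfl
  have hm : Monotone σ := monotone_nat_of_le_succ fun n => by
    rw [hσ]; exact hsub _ _
  let d : ℕ → CompactOp H := fun n => compactProj (σ (n + 1)) - compactProj (σ n)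
  have horth {m n : ℕ} (hmn : m < n) : d m * d n = 0 ∧ d n * d m = 0 := by
    have h1 : σ (m + 1) ⊆ σ n := hm hmn
    have h2 : σ n ⊆ σ (n + 1) := hm n.le_succ
    have h3 : σ m ⊆ σ (m + 1) := hm m.le_succ
    simp only [d, mul_sub, sub_mul]
    rw [mul_compactProj_of_subset (h1.trans h2), mul_compactProj_of_subset h1,
      mul_compactProj_of_subset ((h3.trans h1).trans h2), mul_compactProj_of_subset (h3.trans h1),
      compactProj_mul_of_subset (h1.trans h2), compactProj_mul_of_subset h1,
      compactProj_mul_of_subset ((h3.trans h1).trans h2), compactProj_mul_of_subset (h3.trans h1)]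
    simp
  obtain ⟨n, hn⟩ := exists_norm_lt_of_orthogonal (d := d) (C := 1 + 1) h
    (fun n => (norm_sub_le _ _).trans
      (add_le_add (norm_compactProj_le _) (norm_compactProj_le _)))
    (fun n => by
      have h2 : σ n ⊆ σ (n + 1) := hm n.le_succ
      simp only [d, mul_sub, sub_mul, compactProj_mul_self, compactProj_mul_of_subset h2,
        mul_compactProj_of_subset h2]
      abel)
    (fun m n hmn => by
      rcases lt_or_gt_of_ne hmn with hlt | hlt
      exacts [(horth hlt).1, (horth hlt).2])
  have h1 := hnext (σ n) (‖Υ (compactProj (σ n))‖ + 8 ^ n)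
  rw [← hσ] at h1
  have h2 : ‖Υ (compactProj (σ (n + 1)))‖ - ‖Υ (compactProj (σ n))‖ ≤ ‖Υ (d n)‖ := by
    simp only [d, map_sub]
    exact norm_sub_norm_le _ _
  linarith

end Boundedness

/-! ### Weak operator limits and the value at the identity -/

section WeakLimit

variable {ι H : Type*} [NormedAddCommGroup H] [InnerProductSpace ℂ H]

/-- Convergence of operators along `l` in the weak operator topology. -/
def TendstoWeakly (f : ι → H →L[ℂ] H) (l : Filter ι) (X : H →L[ℂ] H) : Prop :=
  ∀ x y : H, Tendsto (fun i => inner ℂ x (f i y)) l (𝓝 (inner ℂ x (X y)))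

namespace TendstoWeakly

variable {f : ι → H →L[ℂ] H} {l : Filter ι} {X Y : H →L[ℂ] H}

theorem unique [l.NeBot] (hX : TendstoWeakly f l X) (hY : TendstoWeakly f l Y) : X = Y := by
  ext y
  exact ext_inner_left ℂ fun x => tendsto_nhds_unique (hX x y) (hY x y)

theorem of_tendsto (h : Tendsto f l (𝓝 X)) : TendstoWeakly f l X := fun x y =>
  (matrixCoeff (ContinuousLinearMap.id ℂ (H →L[ℂ] H)) x y).continuous.tendsto X |>.comp h

theorem congr' {g : ι → H →L[ℂ] H} (h : TendstoWeakly f l X) (hfg : f =ᶠ[l] g) :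
    TendstoWeakly g l X := fun x y =>
  (h x y).congr' (hfg.mono fun i hi => by rw [hi])

/-- Only multiplication by a fixed operator preserves weak limits, so products of limits are formed
one factor at a time. -/
theorem mul_right (h : TendstoWeakly f l X) (R : H →L[ℂ] H) :
    TendstoWeakly (fun i => f i * R) l (X * R) := fun x y => h x (R y)

theorem mul_left [CompleteSpace H] (h : TendstoWeakly f l X) (R : H →L[ℂ] H) :
    TendstoWeakly (fun i => R * f i) l (R * X) := fun x y => by
  have := h (ContinuousLinearMap.adjoint R x) y
  simp only [ContinuousLinearMap.adjoint_inner_left] at this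
  exact this

end TendstoWeakly

variable {H₁ H₂ : Type*} [NormedAddCommGroup H₁] [InnerProductSpace ℂ H₁] [CompleteSpace H₁]
  [NormedAddCommGroup H₂] [InnerProductSpace ℂ H₂] [CompleteSpace H₂]

/-- A bounded family has a weak* limit in the bidual along any ultrafilter, and the canonical map
reads it as an operator. -/
theorem exists_tendstoWeakly (u : ι → CompactOp H₂) (C : ℝ) (hu : ∀ i, ‖u i‖ ≤ C)
    (U : Ultrafilter ι) :
    ∃ X : H₂ →L[ℂ] H₂, TendstoWeakly (fun i => CompactOp.incl H₂ (u i)) U X := by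
  obtain ⟨F, hF⟩ := exists_bidual_limit u C hu U
  refine ⟨compactBidualToOp H₂ F, fun x y => ?_⟩
  have := hF (matrixCoeff (CompactOp.incl H₂) x y)
  rwa [← inner_opOfBidual] at this

/-- The weak* limit of the projections has matrix coefficients `⟪x, y⟫`, because `p_s y = y` as soon
as `y ∈ s`. It therefore corresponds to the identity operator. -/
theorem tendsto_compactBidualEquiv_symm_one {U : Ultrafilter (Finset H₁)}
    (hU : (U : Filter (Finset H₁)) ≤ atTop) (φ : StrongDual ℂ (CompactOp H₁)) :
    Tendsto (fun s => φ (compactProj s)) U (𝓝 ((compactBidualEquiv H₁).symm 1 φ)) := by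
  obtain ⟨F, hF⟩ := exists_bidual_limit compactProj 1 norm_compactProj_le U
  suffices h : (compactBidualEquiv H₁).symm 1 = F by rw [h]; exact hF φ
  rw [LinearEquiv.symm_apply_eq]
  change 1 = compactBidualToOp H₁ F
  ext y
  refine ext_inner_left ℂ fun x => ?_
  refine Eq.trans ?_ (inner_opOfBidual _ _ _ _).symm
  refine tendsto_nhds_unique (tendsto_const_nhds.congr' (hU ?_)) (hF _)
  filter_upwards [eventually_ge_atTop ({y} : Finset H₁)] with s hs
  change inner ℂ x y = inner ℂ x (spanProj s y)
  rw [spanProj_apply_of_mem (hs (Finset.mem_singleton_self _))]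

/-- A matrix coefficient of `Φ**(1)` is the bidual element `1` evaluated on a functional composed
with `Φ`, so the preceding limit applies. -/
theorem tendstoWeakly_compactBitranspose_one {U : Ultrafilter (Finset H₁)}
    (hU : (U : Filter (Finset H₁)) ≤ atTop) (Φ : CompactOp H₁ →L[ℂ] CompactOp H₂) :
    TendstoWeakly (fun s => CompactOp.incl H₂ (Φ (compactProj s))) U
      (compactBitranspose Φ 1) := fun x y => by
  have h := tendsto_compactBidualEquiv_symm_one hU (matrixCoeff (CompactOp.incl H₂) x y ∘L Φ)
  have e : inner ℂ x (compactBitranspose Φ 1 y) =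
    (compactBidualEquiv H₁).symm 1 (matrixCoeff (CompactOp.incl H₂) x y ∘L Φ) :=
    inner_opOfBidual (CompactOp.incl H₂) (bitranspose Φ ((compactBidualEquiv H₁).symm 1)) x y
  rw [e]
  exact h

theorem tendstoWeakly_weakStarExtension_one {U : Ultrafilter (Finset H₁)}
    (hU : (U : Filter (Finset H₁)) ≤ atTop) (T : CompactOp H₁ →L[ℂ] (H₂ →L[ℂ] H₂)) :
    TendstoWeakly (fun s => T (compactProj s)) U (weakStarExtension T 1) := fun x y => by
  have h := tendsto_compactBidualEquiv_symm_one hU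
    (matrixCoeff (ContinuousLinearMap.id ℂ (H₂ →L[ℂ] H₂)) x y ∘L T)
  have e : inner ℂ x (weakStarExtension T 1 y) = (compactBidualEquiv H₁).symm 1
      (matrixCoeff (ContinuousLinearMap.id ℂ (H₂ →L[ℂ] H₂)) x y ∘L T) :=
    inner_opOfBidual _ (bitranspose T ((compactBidualEquiv H₁).symm 1)) x y
  rw [e]
  exact h

end WeakLimit

/-! ### Passing to the limit in the triple identities -/

section Corner

variable {H₁ H₂ : Type*} [NormedAddCommGroup H₁] [InnerProductSpace ℂ H₁] [CompleteSpace H₁]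
  [NormedAddCommGroup H₂] [InnerProductSpace ℂ H₂]
  {φ : CompactOp H₁ →L[ℂ] (H₂ →L[ℂ] H₂)} {υ : CompactOp H₁ →ₗ[ℂ] (H₂ →L[ℂ] H₂)}
  {U : Ultrafilter (Finset H₁)} {X Y : H₂ →L[ℂ] H₂}

theorem IsJordanTripleMultiplicative.mul_mul_compactProj
    (h : IsJordanTripleMultiplicative (φ : CompactOp H₁ →ₗ[ℂ] (H₂ →L[ℂ] H₂)) υ)
    {q s t : Finset H₁} {a : CompactOp H₁} (ha : compactProj q * a * compactProj q = a)
    (hqs : q ⊆ s) (hst : s ⊆ t) :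
    φ a * υ (compactProj s) * φ (compactProj t) = φ a ∧
      φ (compactProj t) * υ (compactProj s) * φ a = φ a :=
  h.mul_mul_eq_of_corner (q := compactProj q) (s := compactProj s) (t := compactProj t)
    (compactProj_mul_self _) (compactProj_mul_self _)
    (mul_compactProj_of_subset hqs) (compactProj_mul_of_subset hqs)
    (mul_compactProj_of_subset hst) (compactProj_mul_of_subset hst) ha

variable [CompleteSpace H₂]

/-- The weak limits `X` of `φ` and `Y` of `υ` along the finite-rank projections satisfy
`φ(a) Y X = φ(a) = X Y φ(a)` for all `a`. -/
theorem IsJordanTripleMultiplicative.mul_limits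
    (h : IsJordanTripleMultiplicative (φ : CompactOp H₁ →ₗ[ℂ] (H₂ →L[ℂ] H₂)) υ)
    (hU : (U : Filter (Finset H₁)) ≤ atTop)
    (hX : TendstoWeakly (fun s => φ (compactProj s)) U X)
    (hY : TendstoWeakly (fun s => υ (compactProj s)) U Y) (a : CompactOp H₁) :
    φ a * Y * X = φ a ∧ X * Y * φ a = φ a := by
  classical
  have rankOne (x y : H₁) : φ (compactRankOne x y) * Y * X = φ (compactRankOne x y) ∧
      X * Y * φ (compactRankOne x y) = φ (compactRankOne x y) := by
    set r := compactRankOne x y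
    have alg {s t : Finset H₁} (hs : {x, y} ⊆ s) (hst : s ⊆ t) :=
      h.mul_mul_compactProj (compactRankOne_mem_corner x y) hs hst
    -- First limit: `s` is fixed and `t ⊇ s` grows, replacing `φ (compactProj t)` by `X`. The
    -- identity is constant in `t`.
    have inner_limit {s : Finset H₁} (hs : {x, y} ⊆ s) :
        φ r * υ (compactProj s) * X = φ r ∧ X * υ (compactProj s) * φ r = φ r := by
      constructor
      · refine (hX.mul_left (φ r * υ (compactProj s))).unique
          ((TendstoWeakly.of_tendsto tendsto_const_nhds).congr' (hU ?_))
        filter_upwards [eventually_ge_atTop s] with t ht using (alg hs ht).1.symm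
      · refine ((hX.mul_right (υ (compactProj s))).mul_right (φ r)).unique
          ((TendstoWeakly.of_tendsto tendsto_const_nhds).congr' (hU ?_))
        filter_upwards [eventually_ge_atTop s] with t ht using (alg hs ht).2.symm
    -- Second limit: now `s` grows, replacing `υ (compactProj s)` by `Y`.
    constructor
    · refine ((hY.mul_left (φ r)).mul_right X).unique
        ((TendstoWeakly.of_tendsto tendsto_const_nhds).congr' (hU ?_))
      filter_upwards [eventually_ge_atTop {x, y}] with s hs using (inner_limit hs).1.symm
    · refine ((hY.mul_left X).mul_right (φ r)).unique
        ((TendstoWeakly.of_tendsto tendsto_const_nhds).congr' (hU ?_))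
      filter_upwards [eventually_ge_atTop {x, y}] with s hs using (inner_limit hs).2.symm
  constructor
  · rw [mul_assoc]
    exact DFunLike.congr_fun (CompactOp.ext_rankOne
      (f := (ContinuousLinearMap.mul ℂ (H₂ →L[ℂ] H₂)).flip (Y * X) ∘L φ) (g := φ)
      fun x y => (mul_assoc _ _ _).symm.trans (rankOne x y).1) a
  · exact DFunLike.congr_fun (CompactOp.ext_rankOne
      (f := ContinuousLinearMap.mul ℂ (H₂ →L[ℂ] H₂) (X * Y) ∘L φ) (g := φ)
      fun x y => (rankOne x y).2) a

/-- Here `φ(a)υ(p_s)φ(a) = φ(a p_s a)`, and `a p_s a → a²` in norm, so continuity of `φ` suffices on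
the right while the left converges weakly. -/
theorem IsPGInverse.mul_limit_mul
    (h : IsPGInverse (φ : CompactOp H₁ →ₗ[ℂ] (H₂ →L[ℂ] H₂)) υ)
    (hU : (U : Filter (Finset H₁)) ≤ atTop)
    (hY : TendstoWeakly (fun s => υ (compactProj s)) U Y) (a : CompactOp H₁) :
    φ a * Y * φ a = φ (a * a) := by
  refine ((hY.mul_left (φ a)).mul_right (φ a)).unique (TendstoWeakly.of_tendsto ?_)
  have h1 : Tendsto (fun s : Finset H₁ => φ (a * (compactProj s * a))) atTop
      (𝓝 (φ (a * a))) :=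
    (φ.continuous.tendsto _).comp ((tendsto_compactProj_mul a).const_mul a)
  refine (h1.mono_left hU).congr fun s => ?_
  rw [← mul_assoc]
  exact h a (compactProj s)

end Corner

/-! ### Construction of the two Jordan homomorphisms -/

theorem corollary3p6 {H₁ H₂ : Type*}
    [NormedAddCommGroup H₁] [InnerProductSpace ℂ H₁] [CompleteSpace H₁]
    [NormedAddCommGroup H₂] [InnerProductSpace ℂ H₂] [CompleteSpace H₂]
    (Φ : CompactOp H₁ →L[ℂ] CompactOp H₂) (Υ : CompactOp H₁ →ₗ[ℂ] CompactOp H₂)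
    (h : IsJordanTripleMultiplicative (Φ : CompactOp H₁ →ₗ[ℂ] CompactOp H₂) Υ) :
    (∃ T : CompactOp H₁ →L[ℂ] (H₂ →L[ℂ] H₂),
      IsJordanHom (T : CompactOp H₁ →ₗ[ℂ] (H₂ →L[ℂ] H₂)) ∧
      (∀ a : CompactOp H₁, CompactOp.incl H₂ (Φ a) = T a * compactBitranspose Φ 1) ∧
      Set.range (fun b : H₂ →L[ℂ] H₂ => compactBitranspose Φ 1 * b) =
        Set.range (fun b : H₂ →L[ℂ] H₂ => weakStarExtension T 1 * b)) ∧
    (∃ S : CompactOp H₁ →L[ℂ] (H₂ →L[ℂ] H₂),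
      IsJordanHom (S : CompactOp H₁ →ₗ[ℂ] (H₂ →L[ℂ] H₂)) ∧
      (∀ a : CompactOp H₁, CompactOp.incl H₂ (Φ a) = compactBitranspose Φ 1 * S a) ∧
      Set.range (fun b : H₂ →L[ℂ] H₂ => b * compactBitranspose Φ 1) =
        Set.range (fun b : H₂ →L[ℂ] H₂ => b * weakStarExtension S 1)) := by
  let φ : CompactOp H₁ →L[ℂ] (H₂ →L[ℂ] H₂) := CompactOp.incl H₂ ∘L Φ
  let υ : CompactOp H₁ →ₗ[ℂ] (H₂ →L[ℂ] H₂) := (CompactOp.incl H₂).toLinearMap ∘ₗ Υ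
  have hpair : IsJordanTripleMultiplicative (φ : CompactOp H₁ →ₗ[ℂ] (H₂ →L[ℂ] H₂)) υ :=
    ⟨fun a b => congrArg (CompactOp.incl H₂) (h.1 a b),
      fun a b => congrArg (CompactOp.incl H₂) (h.2 a b)⟩
  let U : Ultrafilter (Finset H₁) := Ultrafilter.of atTop
  have hU : (U : Filter (Finset H₁)) ≤ atTop := Ultrafilter.of_le atTop
  obtain ⟨C, hC⟩ := exists_norm_compactProj_le h.2
  obtain ⟨Y, hY⟩ := exists_tendstoWeakly (fun s => Υ (compactProj s)) C hC U
  set X := compactBitranspose Φ 1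
  have hX : TendstoWeakly (fun s => φ (compactProj s)) U X :=
    tendstoWeakly_compactBitranspose_one hU Φ
  have hlim := hpair.mul_limits hU hX hY
  have hsq := hpair.1.mul_limit_mul hU hY
  -- Weak limit of `X Y φ(p_s) = φ(p_s)`.
  have hXYX : X * Y * X = X :=
    (hX.mul_left (X * Y)).unique (hX.congr' (.of_forall fun s => (hlim _).2.symm))
  refine ⟨⟨(ContinuousLinearMap.mul ℂ (H₂ →L[ℂ] H₂)).flip Y ∘L φ, fun a => ?_,
    fun a => (hlim a).1.symm, ?_⟩, ⟨ContinuousLinearMap.mul ℂ (H₂ →L[ℂ] H₂) Y ∘L φ, fun a => ?_,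
    fun a => (hlim a).2.symm.trans (mul_assoc _ _ _), ?_⟩⟩
  -- The Jordan property is `φ(a)Yφ(a) = φ(a²)` multiplied by `Y` on the right.
  · change φ (a * a) * Y = (φ a * Y) * (φ a * Y)
    rw [← hsq, mul_assoc (φ a * Y)]
  · have h1 : weakStarExtension ((ContinuousLinearMap.mul ℂ (H₂ →L[ℂ] H₂)).flip Y ∘L φ) 1
        = X * Y := (tendstoWeakly_weakStarExtension_one hU _).unique (hX.mul_right Y)
    rw [h1]
    -- `X b = XY(X b)` by `XYX = X`, and `XY b = X(Y b)`.
    refine Set.Subset.antisymm ?_ ?_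
    · rintro _ ⟨b, rfl⟩
      exact ⟨X * b, by simp only [← mul_assoc, hXYX]⟩
    · rintro _ ⟨b, rfl⟩
      exact ⟨Y * b, (mul_assoc _ _ _).symm⟩
  · change Y * φ (a * a) = (Y * φ a) * (Y * φ a)
    rw [← hsq]
    simp only [mul_assoc]
  · have h1 : weakStarExtension (ContinuousLinearMap.mul ℂ (H₂ →L[ℂ] H₂) Y ∘L φ) 1
        = Y * X := (tendstoWeakly_weakStarExtension_one hU _).unique (hX.mul_left Y)
    rw [h1]
    refine Set.Subset.antisymm ?_ ?_
    · rintro _ ⟨b, rfl⟩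
      exact ⟨b * X, by simp only [mul_assoc]; rw [← mul_assoc X, hXYX]⟩
    · rintro _ ⟨b, rfl⟩
      exact ⟨b * Y, mul_assoc _ _ _⟩
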